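/- For $n\in\mathbb N$ and $p\in[0,1]$, let $\pi_p^n$ denote the product distribution on $\{0,1\}^n$ under which each coordinate is independently $1$ with probability $p$ and $0$ with probability $1-p$. A function $f:\{0,1\}^n\to\mathbb R$ is monotone if $f(x)\le f(y)$ whenever $x_i\le y_i$ for all $i$, and it is $1$-Lipschitz if $|f(x)-f(y)|\le|\{i : x_i\ne y_i\}|$ for all $x,y\in\{0,1\}^n$. **Boosting lemma.** For every $\sigma>0$ with $1.01\,\sigma\le 1$ there is a constant $C_\sigma>0$ such that the following holds. Let $n\in\mathbb N$, let $f:\{0,1\}^n\to[0,\infty)$ be a monotone $1$-Lipschitz function, and let $\varepsilon\in(0,1/2]$. If a real number $r\ge 1$ satisfies $$\Pr_{x\sim\pi_\sigma^n}\big[f(x)\ge r\big]>\varepsilon,$$ then $$\Pr_{x\sim\pi_{1.01\sigma}^n}\big[f(x)\ge r-C_\sigma^{1/\varepsilon^2}\big]>1-\varepsilon.$$ -/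

import Mathlib

open MeasureTheory ProbabilityTheory

/-- The `p`-biased product distribution `π_p^n` on the hypercube `{0,1}^n` (with `true` for `1` and
`false` for `0`): each coordinate is independently `1` with probability `p` and `0` with
probability `1 - p`. -/
noncomputable def biasedCube (n : ℕ) (p : unitInterval) : Measure (Fin n → Bool) :=
  Measure.pi fun _ => bernoulliMeasure true false p

/-- A real function on the hypercube is `1`-Lipschitz if
`|f x - f y| ≤ #{i | x i ≠ y i}` for all `x`, `y`. -/
def IsOneLipschitz {n : ℕ} (f : (Fin n → Bool) → ℝ) : Prop :=
  ∀ x y : Fin n → Bool, |f x - f y| ≤ (hammingDist x y : ℝ)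

/-!
Write `F` for the indicator of `{r ≤ f}`. By the Margulis–Russo formula the mean of `F` under the
`p`-biased measure has derivative equal to the total influence of `F`, so the mean value theorem
gives a bias `p` between `σ` and `1.005 * σ` at which the total influence is at most a constant `M`
depending on `σ` only (`exists_sum_biasedExp_discDeriv_le`).

At this bias Friedgut's junta theorem applies (`sum_biasedCoeff_sq_not_subset_le`): if `J` is the
set of coordinates of influence more than `s ^ 2`, then the Fourier mass of `F` on sets not
contained in `J` is at most `M / k + M * s * R ^ k` for every level `k`. The proof uses
hypercontractivity (`biasedExp_pow_four_le`) in the form of a level-`k` inequality for the discrete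
derivatives (`sq_sum_low_biasedCoeff_le`). Choosing `k` of order `M / ε ^ 2` and `s` exponentially
small in `k` makes this mass at most `ε ^ 2 / 2`, while `#J ≤ M / s ^ 2` is at most `C ^ (1 / ε ^ 2)`.

Now let `F'` be the indicator of the event that `f` is at least `r` after all coordinates in `J`
have been raised to `1`. It ignores `J` and lies above `F`. If its mean were at most `1 - ε`, then on
the complementary event, which is independent of `J` and has probability at least `ε`, the function
`F` would vanish, and `F` would be too far from its conditional expectation given `J`
(`one_sub_lt_biasedExp_of_junta`). So `F'` has mean more than `1 - ε`, and as `f` is `1`-Lipschitz,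
`F' x = 1` implies `r - #J ≤ f x`. Monotonicity in the bias carries this from `p` to `1.01 * σ`.
-/

open Finset Function

/-! ### Expectations under the biased product distribution -/

/-- The mass that a `p`-biased bit gives to `b`, as a polynomial in the real variable `p`. -/
def bitWeight (p : ℝ) (b : Bool) : ℝ := if b then p else 1 - p

/-- The expectation of `F` under the `p`-biased product distribution on `ι → Bool`, written as a
finite sum, so that it is a polynomial in `p` and makes sense for every real `p`. -/
def biasedExp {ι : Type*} [Fintype ι] [DecidableEq ι] (p : ℝ) (F : (ι → Bool) → ℝ) : ℝ :=
  ∑ x, (∏ i, bitWeight p (x i)) * F x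

section BiasedExp

variable {ι : Type*} [Fintype ι] [DecidableEq ι] {p : ℝ}

lemma bitWeight_nonneg (h0 : 0 ≤ p) (h1 : p ≤ 1) (b : Bool) : 0 ≤ bitWeight p b := by
  cases b <;> simp [bitWeight] <;> linarith

lemma biasedExp_add (F G : (ι → Bool) → ℝ) :
    biasedExp p (fun x => F x + G x) = biasedExp p F + biasedExp p G := by
  simp [biasedExp, mul_add, sum_add_distrib]

lemma biasedExp_const_mul (c : ℝ) (F : (ι → Bool) → ℝ) :
    biasedExp p (fun x => c * F x) = c * biasedExp p F := by
  simp only [biasedExp, mul_sum]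
  exact sum_congr rfl fun x _ => by ring

lemma biasedExp_sum {κ : Type*} (s : Finset κ) (F : κ → (ι → Bool) → ℝ) :
    biasedExp p (fun x => ∑ k ∈ s, F k x) = ∑ k ∈ s, biasedExp p (F k) := by
  simp only [biasedExp, mul_sum]
  exact sum_comm

lemma biasedExp_mono (h0 : 0 ≤ p) (h1 : p ≤ 1) {F G : (ι → Bool) → ℝ} (h : ∀ x, F x ≤ G x) :
    biasedExp p F ≤ biasedExp p G :=
  sum_le_sum fun x _ =>
    mul_le_mul_of_nonneg_left (h x) (prod_nonneg fun _ _ => bitWeight_nonneg h0 h1 _)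

lemma biasedExp_prod (g : ι → Bool → ℝ) :
    biasedExp p (fun x => ∏ i, g i (x i)) = ∏ i, (p * g i true + (1 - p) * g i false) := by
  have h := Finset.prod_univ_sum (fun _ : ι => (univ : Finset Bool))
    (fun i b => bitWeight p b * g i b)
  simp only [Fintype.piFinset_univ, Fintype.sum_bool] at h
  simp only [biasedExp, ← prod_mul_distrib]
  rw [← h]
  simp [bitWeight]

lemma biasedExp_one : biasedExp p (fun _ : ι → Bool => 1) = 1 := by
  simpa using biasedExp_prod (ι := ι) (p := p) (fun _ _ => 1)

lemma biasedExp_const (c : ℝ) : biasedExp p (fun _ : ι → Bool => c) = c := by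
  simpa [biasedExp_one] using biasedExp_const_mul (ι := ι) (p := p) c (fun _ => 1)

lemma biasedExp_nonneg (h0 : 0 ≤ p) (h1 : p ≤ 1) {F : (ι → Bool) → ℝ} (h : ∀ x, 0 ≤ F x) :
    0 ≤ biasedExp p F := by
  simpa [biasedExp_const] using biasedExp_mono h0 h1 h

lemma sq_biasedExp_mul_le (h0 : 0 ≤ p) (h1 : p ≤ 1) (F G : (ι → Bool) → ℝ) :
    biasedExp p (fun x => F x * G x) ^ 2 ≤
      biasedExp p (fun x => F x ^ 2) * biasedExp p (fun x => G x ^ 2) := by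
  have hw (x : ι → Bool) : 0 ≤ ∏ i, bitWeight p (x i) :=
    prod_nonneg fun _ _ => bitWeight_nonneg h0 h1 _
  refine sum_sq_le_sum_mul_sum_of_sq_le_mul _ (fun x _ => mul_nonneg (hw x) (sq_nonneg _))
    (fun x _ => mul_nonneg (hw x) (sq_nonneg _)) fun x _ => le_of_eq (by ring)

/-- Summing out the `i`-th coordinate with unit weights is the same as leaving its factor out of the
product of weights. -/
lemma biasedExp_update_add (i : ι) (H : (ι → Bool) → ℝ) :
    biasedExp p (fun x => H (update x i true) + H (update x i false)) =
      ∑ x, (∏ j ∈ univ.erase i, bitWeight p (x j)) * H x := by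
  -- Pair `x` with the point `flip x` that differs from it in the coordinate `i` alone.
  have hinv : Involutive fun x : ι → Bool => update x i (!(x i)) := fun x => by simp
  have hpt (x : ι → Bool) : H (update x i true) + H (update x i false) =
      H x + H (update x i (!(x i))) := by
    rcases hx : x i with _ | _
    · rw [← hx, update_eq_self, hx, add_comm]; rfl
    · rw [← hx, update_eq_self, hx]; rfl
  have hflip : ∑ x : ι → Bool, (∏ j, bitWeight p (x j)) * H (update x i (!(x i))) =
      ∑ x : ι → Bool, (∏ j, bitWeight p (update x i (!(x i)) j)) * H x := by
    rw [← Equiv.sum_comp hinv.toPerm]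
    simp [Involutive.coe_toPerm]
  simp only [biasedExp, hpt, mul_add, sum_add_distrib, hflip]
  rw [← sum_add_distrib]
  refine sum_congr rfl fun x _ => ?_
  have hrest : ∏ j ∈ univ.erase i, bitWeight p (update x i (!(x i)) j) =
      ∏ j ∈ univ.erase i, bitWeight p (x j) :=
    prod_congr rfl fun j hj => by rw [update_of_ne (ne_of_mem_erase hj)]
  rw [← mul_prod_erase univ _ (mem_univ i), ← mul_prod_erase univ
    (fun j => bitWeight p (update x i (!(x i)) j)) (mem_univ i), hrest]
  cases hx : x i <;> simp [bitWeight] <;> ring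

/-- Conditioning on all coordinates but the `i`-th. -/
lemma biasedExp_eq_update (i : ι) (F : (ι → Bool) → ℝ) :
    biasedExp p F =
      biasedExp p (fun x => p * F (update x i true) + (1 - p) * F (update x i false)) := by
  have h := biasedExp_update_add (p := p) i (fun x => bitWeight p (x i) * F x)
  simp only [update_self] at h
  simp only [bitWeight, if_true, Bool.false_eq_true, if_false] at h
  rw [h, biasedExp]
  refine sum_congr rfl fun x _ => ?_
  rw [← mul_prod_erase univ _ (mem_univ i)]
  simp only [bitWeight]
  ring

/-- The discrete derivative of `F` in direction `i`. -/
def discDeriv (i : ι) (F : (ι → Bool) → ℝ) (x : ι → Bool) : ℝ :=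
  F (update x i true) - F (update x i false)

/-- The Margulis–Russo formula. -/
lemma hasDerivAt_biasedExp (F : (ι → Bool) → ℝ) (p : ℝ) :
    HasDerivAt (fun p => biasedExp p F) (∑ i, biasedExp p (discDeriv i F)) p := by
  have hbit (b : Bool) : HasDerivAt (fun p => bitWeight p b) (if b then 1 else -1) p := by
    cases b
    · simpa [bitWeight] using (hasDerivAt_id p).const_sub 1
    · simpa [bitWeight] using hasDerivAt_id' p
  have hsum : HasDerivAt (fun p => biasedExp p F)
      (∑ x : ι → Bool, (∑ i, (∏ j ∈ univ.erase i, bitWeight p (x j)) •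
        (if x i then (1 : ℝ) else -1)) * F x) p := by
    refine HasDerivAt.fun_sum fun x _ => ?_
    exact (HasDerivAt.fun_finsetProd fun i _ => hbit (x i)).mul_const (F x)
  convert hsum using 1
  simp only [sum_mul]
  rw [sum_comm]
  refine sum_congr rfl fun i _ => ?_
  have h := biasedExp_update_add (p := p) i (fun x => (if x i then (1 : ℝ) else -1) * F x)
  simp only [update_self, if_true, Bool.false_eq_true, if_false, one_mul, neg_one_mul,
    ← sub_eq_add_neg] at h
  refine h.trans (sum_congr rfl fun x _ => ?_)
  rw [smul_eq_mul]; ring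

end BiasedExp

lemma biasedCube_real_eq {n : ℕ} (p : unitInterval) (A : Set (Fin n → Bool)) :
    (biasedCube n p).real A = biasedExp (p : ℝ) (A.indicator 1) := by
  classical
  have : IsProbabilityMeasure (biasedCube n p) := by unfold biasedCube; infer_instance
  have hpt (x : Fin n → Bool) : (biasedCube n p).real {x} = ∏ i, bitWeight p (x i) := by
    rw [biasedCube, measureReal_def, Measure.pi_singleton, ENNReal.toReal_prod]
    refine prod_congr rfl fun i _ => ?_
    rw [← measureReal_def, bernoulliMeasure_real_apply _ (measurableSet_singleton _)]
    cases h : x i <;> simp [bitWeight]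
  have hA : (biasedCube n p).real A =
      ∑ x ∈ univ.filter (· ∈ A), (biasedCube n p).real {x} := by
    rw [sum_measureReal_singleton]; simp
  rw [hA, sum_filter, biasedExp]
  refine sum_congr rfl fun x _ => ?_
  rw [hpt, Set.indicator_apply]
  split_ifs <;> simp

/-! ### Fourier analysis on the biased cube -/

/-- The `p`-biased bit `b`, centred and normalised to variance one. -/
noncomputable def normBit (p : ℝ) (b : Bool) : ℝ :=
  ((if b then 1 else 0) - p) / √(p * (1 - p))

/-- The `p`-biased Fourier character of a set `S` of coordinates. -/
noncomputable def biasedChar {ι : Type*} (p : ℝ) (S : Finset ι) (x : ι → Bool) : ℝ :=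
  ∏ i ∈ S, normBit p (x i)

/-- The `p`-biased Fourier coefficient of `F` at `S`. -/
noncomputable def biasedCoeff {ι : Type*} [Fintype ι] [DecidableEq ι] (p : ℝ)
    (F : (ι → Bool) → ℝ) (S : Finset ι) : ℝ :=
  biasedExp p (fun x => F x * biasedChar p S x)

section Fourier

variable {ι : Type*} {p : ℝ}

lemma normBit_mean : p * normBit p true + (1 - p) * normBit p false = 0 := by
  simp only [normBit, if_true, Bool.false_eq_true, if_false]
  ring

lemma normBit_variance (h0 : 0 < p) (h1 : p < 1) :
    p * normBit p true ^ 2 + (1 - p) * normBit p false ^ 2 = 1 := by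
  have hq : 0 < 1 - p := sub_pos.2 h1
  simp only [normBit, if_true, Bool.false_eq_true, if_false, div_pow,
    Real.sq_sqrt (mul_pos h0 hq).le]
  field_simp
  ring

lemma normBit_sq_le (h0 : 0 < p) (h1 : p < 1) {Λ : ℝ} (hp : 1 ≤ Λ * p) (hq : 1 ≤ Λ * (1 - p))
    (b : Bool) : normBit p b ^ 2 ≤ Λ := by
  have hq' : 0 < 1 - p := sub_pos.2 h1
  rw [normBit, div_pow, Real.sq_sqrt (mul_pos h0 hq').le, div_le_iff₀ (mul_pos h0 hq')]
  cases b
  · simp only [Bool.false_eq_true, if_false]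
    nlinarith
  · simp only [if_true]
    nlinarith

/-- The reproducing kernel of the characters is the point mass divided by the weight. -/
lemma sum_biasedChar_mul [Fintype ι] (h0 : 0 < p) (h1 : p < 1) (x y : ι → Bool) :
    (∏ i, bitWeight p (y i)) * ∑ S, biasedChar p S x * biasedChar p S y =
      if y = x then 1 else 0 := by
  have hq : 0 < 1 - p := sub_pos.2 h1
  have hbit (a b : Bool) :
      bitWeight p b * (1 + normBit p a * normBit p b) = if b = a then 1 else 0 := by
    have hs : √(p * (1 - p)) * √(p * (1 - p)) = p * (1 - p) :=
      Real.mul_self_sqrt (mul_pos h0 hq).le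
    cases a <;> cases b <;> simp only [normBit, bitWeight, if_true, Bool.false_eq_true, if_false,
      div_mul_div_comm, hs, reduceCtorEq] <;> field_simp <;> ring
  have hprod : ∑ S, biasedChar p S x * biasedChar p S y =
      ∏ i, (1 + normBit p (x i) * normBit p (y i)) := by
    classical
    rw [prod_one_add, powerset_univ]
    simp [biasedChar, prod_mul_distrib]
  rw [hprod, ← prod_mul_distrib]
  simp only [hbit]
  rw [prod_ite_zero]
  simp [funext_iff]

variable [DecidableEq ι]

lemma biasedChar_update_of_notMem {S : Finset ι} {i : ι} (hi : i ∉ S) (x : ι → Bool) (b : Bool) :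
    biasedChar p S (update x i b) = biasedChar p S x :=
  prod_congr rfl fun j hj => by rw [update_of_ne (ne_of_mem_of_not_mem hj hi)]

lemma biasedChar_update_of_mem {S : Finset ι} {i : ι} (hi : i ∈ S) (x : ι → Bool) (b : Bool) :
    biasedChar p S (update x i b) = normBit p b * biasedChar p (S.erase i) x := by
  rw [biasedChar, ← mul_prod_erase S _ hi, update_self]
  congr 1
  exact biasedChar_update_of_notMem (notMem_erase i S) x b

variable [Fintype ι]

lemma sum_biasedCoeff_mul_biasedChar (h0 : 0 < p) (h1 : p < 1) (F : (ι → Bool) → ℝ)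
    (x : ι → Bool) : F x = ∑ S, biasedCoeff p F S * biasedChar p S x := by
  have h : ∑ S, biasedCoeff p F S * biasedChar p S x =
      ∑ y, F y * ((∏ i, bitWeight p (y i)) * ∑ S, biasedChar p S x * biasedChar p S y) := by
    simp only [biasedCoeff, biasedExp, sum_mul, mul_sum]
    rw [sum_comm]
    exact sum_congr rfl fun y _ => sum_congr rfl fun S _ => by ring
  rw [h]
  simp [sum_biasedChar_mul h0 h1]

/-- Parseval's identity. -/
lemma biasedExp_mul (h0 : 0 < p) (h1 : p < 1) (F G : (ι → Bool) → ℝ) :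
    biasedExp p (fun x => F x * G x) = ∑ S, biasedCoeff p F S * biasedCoeff p G S := by
  have h : (fun x => F x * G x) =
      fun x => ∑ S, biasedCoeff p F S * (G x * biasedChar p S x) := by
    funext x
    rw [sum_biasedCoeff_mul_biasedChar h0 h1 F x, sum_mul]
    exact sum_congr rfl fun S _ => by ring
  rw [h, biasedExp_sum]
  simp only [biasedExp_const_mul]
  rfl

lemma biasedExp_sq (h0 : 0 < p) (h1 : p < 1) (F : (ι → Bool) → ℝ) :
    biasedExp p (fun x => F x ^ 2) = ∑ S, biasedCoeff p F S ^ 2 := by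
  simpa only [pow_two] using biasedExp_mul h0 h1 F F

lemma biasedCoeff_biasedChar (h0 : 0 < p) (h1 : p < 1) (S T : Finset ι) :
    biasedCoeff p (biasedChar p S) T = if S = T then 1 else 0 := by
  have h : (fun x => biasedChar p S x * biasedChar p T x) = fun x : ι → Bool =>
      ∏ i, ((if i ∈ S then normBit p (x i) else 1) * (if i ∈ T then normBit p (x i) else 1)) := by
    funext x
    rw [prod_mul_distrib]
    simp [biasedChar]
  have hfac (i : ι) : p * ((if i ∈ S then normBit p true else 1) *
        (if i ∈ T then normBit p true else 1)) +
      (1 - p) * ((if i ∈ S then normBit p false else 1) *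
        (if i ∈ T then normBit p false else 1)) = if (i ∈ S ↔ i ∈ T) then 1 else 0 := by
    have hm := normBit_mean (p := p)
    have hv := normBit_variance h0 h1
    by_cases hS : i ∈ S <;> by_cases hT : i ∈ T <;> simp only [hS, hT, if_true, if_false,
      iff_false, iff_true, not_true_eq_false] <;> linarith
  rw [biasedCoeff, h, biasedExp_prod (fun i b => (if i ∈ S then normBit p b else 1) *
    (if i ∈ T then normBit p b else 1))]
  simp only [hfac]
  rw [prod_ite_zero]
  simp [Finset.ext_iff]

lemma biasedCoeff_sum_biasedChar (h0 : 0 < p) (h1 : p < 1) (a : Finset ι → ℝ) (T : Finset ι) :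
    biasedCoeff p (fun x => ∑ S, a S * biasedChar p S x) T = a T := by
  have h : (fun x => (∑ S, a S * biasedChar p S x) * biasedChar p T x) =
      fun x => ∑ S, a S * (biasedChar p S x * biasedChar p T x) := by
    funext x
    rw [sum_mul]
    exact sum_congr rfl fun S _ => by ring
  rw [biasedCoeff, h, biasedExp_sum]
  simp only [biasedExp_const_mul]
  change ∑ S, a S * biasedCoeff p (biasedChar p S) T = a T
  simp [biasedCoeff_biasedChar h0 h1]

lemma biasedCoeff_empty (F : (ι → Bool) → ℝ) : biasedCoeff p F ∅ = biasedExp p F := by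
  simp [biasedCoeff, biasedChar]

lemma biasedCoeff_eq_zero_of_update {F : (ι → Bool) → ℝ} {i : ι}
    (hF : ∀ x b, F (update x i b) = F x) {S : Finset ι} (hi : i ∈ S) : biasedCoeff p F S = 0 := by
  rw [biasedCoeff, biasedExp_eq_update i]
  have h (x : ι → Bool) : p * (F (update x i true) * biasedChar p S (update x i true)) +
      (1 - p) * (F (update x i false) * biasedChar p S (update x i false)) = 0 := by
    rw [hF, hF, biasedChar_update_of_mem hi, biasedChar_update_of_mem hi]
    linear_combination F x * biasedChar p (S.erase i) x * normBit_mean (p := p)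
  simp only [h, biasedExp_const]

/-- Functions of disjoint sets of coordinates are independent. -/
lemma biasedExp_mul_of_update (h0 : 0 < p) (h1 : p < 1) {F G : (ι → Bool) → ℝ} {J : Finset ι}
    (hF : ∀ i ∉ J, ∀ x b, F (update x i b) = F x) (hG : ∀ i ∈ J, ∀ x b, G (update x i b) = G x) :
    biasedExp p (fun x => F x * G x) = biasedExp p F * biasedExp p G := by
  rw [biasedExp_mul h0 h1, ← biasedCoeff_empty F, ← biasedCoeff_empty G]
  refine sum_eq_single ∅ (fun S _ hS => ?_) (by simp)
  obtain ⟨i, hi⟩ := nonempty_iff_ne_empty.2 hS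
  by_cases hJ : i ∈ J
  · rw [biasedCoeff_eq_zero_of_update (hG i hJ) hi, mul_zero]
  · rw [biasedCoeff_eq_zero_of_update (hF i hJ) hi, zero_mul]

lemma biasedCoeff_eq_discDeriv (h0 : 0 < p) (h1 : p < 1) (F : (ι → Bool) → ℝ) {i : ι}
    {S : Finset ι} (hi : i ∈ S) :
    biasedCoeff p F S = √(p * (1 - p)) * biasedCoeff p (discDeriv i F) (S.erase i) := by
  have hs : 0 < √(p * (1 - p)) := Real.sqrt_pos.2 (mul_pos h0 (sub_pos.2 h1))
  have hs2 : √(p * (1 - p)) ^ 2 = p * (1 - p) := Real.sq_sqrt (mul_pos h0 (sub_pos.2 h1)).le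
  have ht : p * normBit p true = √(p * (1 - p)) := by
    simp only [normBit, if_true]
    field_simp
    linarith
  have hf : (1 - p) * normBit p false = -√(p * (1 - p)) := by
    linarith [normBit_mean (p := p)]
  rw [biasedCoeff, biasedExp_eq_update i, biasedCoeff, ← biasedExp_const_mul]
  congr 1
  funext x
  rw [biasedChar_update_of_mem hi, biasedChar_update_of_mem hi, discDeriv]
  linear_combination F (update x i true) * biasedChar p (S.erase i) x * ht +
    F (update x i false) * biasedChar p (S.erase i) x * hf

/-- The Fourier mass of `F` on sets containing `i` is at most that of its discrete derivative. -/
lemma sum_biasedCoeff_sq_le_discDeriv (h0 : 0 < p) (h1 : p < 1) (F : (ι → Bool) → ℝ) (i : ι)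
    (k : ℕ) :
    ∑ S with i ∈ S ∧ #S ≤ k, biasedCoeff p F S ^ 2 ≤
      ∑ T with #T ≤ k, biasedCoeff p (discDeriv i F) T ^ 2 := by
  have hle : ∀ S ∈ univ.filter (fun S : Finset ι => i ∈ S ∧ #S ≤ k), biasedCoeff p F S ^ 2 ≤
      biasedCoeff p (discDeriv i F) (S.erase i) ^ 2 := fun S hS => by
    rw [biasedCoeff_eq_discDeriv h0 h1 F (mem_filter.1 hS).2.1, mul_pow,
      Real.sq_sqrt (mul_pos h0 (sub_pos.2 h1)).le]
    exact mul_le_of_le_one_left (sq_nonneg _) (by nlinarith)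
  refine (sum_le_sum hle).trans ?_
  have hinj : Set.InjOn (fun S : Finset ι => S.erase i)
      (univ.filter (fun S : Finset ι => i ∈ S ∧ #S ≤ k)) := fun S hS T hT h => by
    have hS' : i ∈ S := (mem_filter.1 (mem_coe.1 hS)).2.1
    have hT' : i ∈ T := (mem_filter.1 (mem_coe.1 hT)).2.1
    rw [← insert_erase hS', ← insert_erase hT']
    exact congrArg (insert i) h
  rw [← sum_image (f := fun T => biasedCoeff p (discDeriv i F) T ^ 2) hinj]
  refine sum_le_sum_of_subset_of_nonneg (fun T hT => ?_) fun _ _ _ => sq_nonneg _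
  obtain ⟨S, hS, rfl⟩ := mem_image.1 hT
  exact mem_filter.2 ⟨mem_univ _, (card_le_card (erase_subset i S)).trans (mem_filter.1 hS).2.2⟩

end Fourier

/-! ### Hypercontractivity and juntas -/

section Hypercontractivity

variable {ι : Type*} [Fintype ι] [DecidableEq ι] {p Λ : ℝ}

/-- The two-point inequality behind hypercontractivity. -/
lemma normBit_two_point (h0 : 0 < p) (h1 : p < 1) (hΛ : ∀ b, normBit p b ^ 2 ≤ Λ) (g h : ℝ) :
    p * (g + normBit p true * h) ^ 4 + (1 - p) * (g + normBit p false * h) ^ 4 ≤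
      g ^ 4 + 8 * (g ^ 2 * h ^ 2) + 3 * Λ * h ^ 4 := by
  -- The cubic term is split by AM-GM; the linear term averages to zero.
  have key (b : Bool) : (g + normBit p b * h) ^ 4 ≤ g ^ 4 + 4 * g ^ 3 * h * normBit p b +
      normBit p b ^ 2 * (8 * (g ^ 2 * h ^ 2) + 3 * Λ * h ^ 4) := by
    have hb := hΛ b
    set φ := normBit p b
    have e1 : 0 ≤ (Λ - φ ^ 2) * (φ ^ 2 * h ^ 4) :=
      mul_nonneg (sub_nonneg.2 hb) (by positivity)
    have e2 : 0 ≤ (φ * h) ^ 2 * (g - φ * h) ^ 2 := by positivity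
    nlinarith
  have ht := mul_le_mul_of_nonneg_left (key true) h0.le
  have hf := mul_le_mul_of_nonneg_left (key false) (sub_pos.2 h1).le
  refine (add_le_add ht hf).trans (le_of_eq ?_)
  linear_combination 4 * g ^ 3 * h * normBit_mean (p := p) +
    (8 * (g ^ 2 * h ^ 2) + 3 * Λ * h ^ 4) * normBit_variance h0 h1

/-- Hypercontractivity of the biased noise operator from `L²` to `L⁴`, with the noise moved to the
coefficients on the right-hand side. -/
lemma biasedExp_pow_four_le (h0 : 0 < p) (h1 : p < 1) (hΛ1 : 1 ≤ Λ)
    (hΛ : ∀ b, normBit p b ^ 2 ≤ Λ) (U : Finset ι) (a : Finset ι → ℝ) :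
    biasedExp p (fun x => (∑ S ∈ U.powerset, a S * biasedChar p S x) ^ 4) ≤
      (∑ S ∈ U.powerset, (4 * Λ) ^ #S * a S ^ 2) ^ 2 := by
  have hΛ0 : 0 ≤ Λ := by linarith
  induction U using Finset.induction_on generalizing a with
  | empty => simp [biasedChar, biasedExp_const, ← pow_mul]
  | insert i U hi ih =>
    set g : (ι → Bool) → ℝ := fun x => ∑ S ∈ U.powerset, a S * biasedChar p S x with hg
    set h : (ι → Bool) → ℝ :=
      fun x => ∑ S ∈ U.powerset, a (insert i S) * biasedChar p S x with hh
    set A := ∑ S ∈ U.powerset, (4 * Λ) ^ #S * a S ^ 2 with hA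
    set B := ∑ S ∈ U.powerset, (4 * Λ) ^ #S * a (insert i S) ^ 2 with hB
    have hnot {S : Finset ι} (hS : S ∈ U.powerset) : i ∉ S := fun h => hi (mem_powerset.1 hS h)
    have hsplit (x : ι → Bool) : ∑ S ∈ (insert i U).powerset, a S * biasedChar p S x =
        g x + normBit p (x i) * h x := by
      rw [sum_powerset_insert hi, hg, hh, mul_sum]
      refine congrArg₂ _ rfl (sum_congr rfl fun S hS => ?_)
      rw [biasedChar, prod_insert (hnot hS), biasedChar]
      ring
    have hAB : ∑ S ∈ (insert i U).powerset, (4 * Λ) ^ #S * a S ^ 2 = A + 4 * Λ * B := by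
      rw [sum_powerset_insert hi, hA, hB, mul_sum]
      refine congrArg₂ _ rfl (sum_congr rfl fun S hS => ?_)
      rw [card_insert_of_notMem (hnot hS)]
      ring
    have hgu (x : ι → Bool) (b : Bool) : g (update x i b) = g x :=
      sum_congr rfl fun S hS => by rw [biasedChar_update_of_notMem (hnot hS)]
    have hhu (x : ι → Bool) (b : Bool) : h (update x i b) = h x :=
      sum_congr rfl fun S hS => by rw [biasedChar_update_of_notMem (hnot hS)]
    have hA0 : 0 ≤ A := sum_nonneg fun S _ => by positivity
    have hB0 : 0 ≤ B := sum_nonneg fun S _ => by positivity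
    have ihA : biasedExp p (fun x => g x ^ 4) ≤ A ^ 2 := ih a
    have ihB : biasedExp p (fun x => h x ^ 4) ≤ B ^ 2 := ih fun S => a (insert i S)
    have hcs : biasedExp p (fun x => g x ^ 2 * h x ^ 2) ≤ A * B := by
      refine le_of_sq_le_sq ?_ (mul_nonneg hA0 hB0)
      refine (sq_biasedExp_mul_le h0.le h1.le _ _).trans ?_
      simp only [← pow_mul, mul_pow]
      exact mul_le_mul ihA ihB
        (biasedExp_nonneg h0.le h1.le fun x => by rw [pow_mul]; exact sq_nonneg _)
        (sq_nonneg A)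
    simp only [hsplit, hAB]
    rw [biasedExp_eq_update i]
    simp only [hgu, hhu, update_self]
    refine (biasedExp_mono h0.le h1.le fun x => normBit_two_point h0 h1 hΛ (g x) (h x)).trans ?_
    rw [biasedExp_add, biasedExp_add, biasedExp_const_mul, biasedExp_const_mul]
    nlinarith [mul_nonneg hA0 hB0, mul_nonneg (sub_nonneg.2 hΛ1) (mul_nonneg hA0 hB0),
      mul_nonneg (sub_nonneg.2 hΛ1) (sq_nonneg B), sq_nonneg (Λ * B), sq_nonneg B,
      mul_le_mul_of_nonneg_left ihB (by linarith : 0 ≤ 3 * Λ),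
      mul_nonneg (mul_nonneg (sub_nonneg.2 hΛ1) (by linarith : 0 ≤ Λ)) (sq_nonneg B)]

/-- The level-`k` inequality: a Boolean function of small mean has little Fourier mass on low
levels. -/
lemma sq_sum_low_biasedCoeff_le (h0 : 0 < p) (h1 : p < 1) (hΛ1 : 1 ≤ Λ)
    (hΛ : ∀ b, normBit p b ^ 2 ≤ Λ) {G : (ι → Bool) → ℝ} (hG : ∀ x, G x ^ 2 = G x) (k : ℕ) :
    (∑ T with #T ≤ k, biasedCoeff p G T ^ 2) ^ 2 ≤ biasedExp p G ^ 3 * ((4 * Λ) ^ k) ^ 2 := by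
  set L := ∑ T with #T ≤ k, biasedCoeff p G T ^ 2 with hL
  set a : Finset ι → ℝ := fun T => if #T ≤ k then biasedCoeff p G T else 0 with ha
  set u : (ι → Bool) → ℝ := fun x => ∑ T, a T * biasedChar p T x with hu
  have hL0 : 0 ≤ L := sum_nonneg fun _ _ => sq_nonneg _
  have hG0 (x : ι → Bool) : 0 ≤ G x := by rw [← hG]; positivity
  have hv0 : 0 ≤ biasedExp p G := biasedExp_nonneg h0.le h1.le hG0
  have hGu : biasedExp p (fun x => G x * u x) = L := by
    rw [biasedExp_mul h0 h1, hL, sum_filter]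
    refine sum_congr rfl fun T _ => ?_
    rw [hu, biasedCoeff_sum_biasedChar h0 h1, ha]
    split_ifs with h <;> simp [h, pow_two]
  have hu4 : biasedExp p (fun x => u x ^ 4) ≤ ((4 * Λ) ^ k * L) ^ 2 := by
    have h4 := biasedExp_pow_four_le h0 h1 hΛ1 hΛ univ a
    rw [powerset_univ] at h4
    refine h4.trans (pow_le_pow_left₀ (sum_nonneg fun S _ => by positivity) ?_ 2)
    rw [hL, mul_sum, sum_filter]
    refine sum_le_sum fun T _ => ?_
    simp only [ha]
    split_ifs with h
    · exact mul_le_mul_of_nonneg_right (pow_le_pow_right₀ (by linarith) h) (sq_nonneg _)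
    · simp
  -- Two applications of Cauchy–Schwarz replace Hölder's inequality with exponents `4/3` and `4`.
  have c1 : L ^ 2 ≤ biasedExp p G * biasedExp p (fun x => G x * u x ^ 2) := by
    have h := sq_biasedExp_mul_le h0.le h1.le G (fun x => G x * u x)
    simp only [← mul_assoc, ← pow_two, mul_pow, hG] at h
    rwa [hGu] at h
  have c2 : biasedExp p (fun x => G x * u x ^ 2) ^ 2 ≤
      biasedExp p G * ((4 * Λ) ^ k * L) ^ 2 := by
    have h := sq_biasedExp_mul_le h0.le h1.le G (fun x => u x ^ 2)
    simp only [← pow_mul, hG] at h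
    exact h.trans (mul_le_mul_of_nonneg_left hu4 hv0)
  have c3 : L ^ 2 * L ^ 2 ≤ L ^ 2 * (biasedExp p G ^ 3 * ((4 * Λ) ^ k) ^ 2) := by
    have h := mul_le_mul_of_nonneg_left c2 (sq_nonneg (biasedExp p G))
    have h' := pow_le_pow_left₀ (sq_nonneg L) c1 2
    linarith
  rcases hL0.eq_or_lt with h | h
  · rw [← h, zero_pow two_ne_zero]
    positivity
  · exact le_of_mul_le_mul_left c3 (by positivity)

end Hypercontractivity

section Junta

variable {ι : Type*} [Fintype ι] [DecidableEq ι] {p : ℝ}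

lemma sum_card_mul_biasedCoeff_sq_le (h0 : 0 < p) (h1 : p < 1) (F : (ι → Bool) → ℝ) :
    ∑ S : Finset ι, (#S : ℝ) * biasedCoeff p F S ^ 2 ≤
      ∑ i, biasedExp p (fun x => discDeriv i F x ^ 2) := by
  have h : ∑ S : Finset ι, (#S : ℝ) * biasedCoeff p F S ^ 2 =
      ∑ i, ∑ S with i ∈ S ∧ #S ≤ Fintype.card ι, biasedCoeff p F S ^ 2 := by
    simp only [card_le_univ, and_true, sum_filter]
    rw [sum_comm]
    refine sum_congr rfl fun S _ => ?_
    rw [← sum_filter]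
    simp
  rw [h]
  refine sum_le_sum fun i _ => (sum_biasedCoeff_sq_le_discDeriv h0 h1 F i _).trans ?_
  simp [card_le_univ, biasedExp_sq h0 h1]

/-- Friedgut's junta theorem for the biased cube: outside the coordinates of influence at least
`s ^ 2` there is little Fourier mass. The levels above `k` are controlled by the total influence,
those up to `k` by the level-`k` inequality applied to the discrete derivatives. -/
lemma sum_biasedCoeff_sq_not_subset_le (h0 : 0 < p) (h1 : p < 1) {Λ : ℝ} (hΛ1 : 1 ≤ Λ)
    (hΛ : ∀ b, normBit p b ^ 2 ≤ Λ) {F : (ι → Bool) → ℝ}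
    (hD : ∀ i x, discDeriv i F x ^ 2 = discDeriv i F x) {M s : ℝ} (hs : 0 < s)
    (hM : ∑ i, biasedExp p (discDeriv i F) ≤ M) {k : ℕ} (hk : 0 < k) {J : Finset ι}
    (hJ : ∀ i ∉ J, biasedExp p (discDeriv i F) ≤ s ^ 2) :
    ∑ S with ¬ S ⊆ J, biasedCoeff p F S ^ 2 ≤ M / k + M * (s * (4 * Λ) ^ k) := by
  have hk' : (0 : ℝ) < k := by exact_mod_cast hk
  have hD0 (i : ι) : 0 ≤ biasedExp p (discDeriv i F) :=
    biasedExp_nonneg h0.le h1.le fun x => by rw [← hD]; positivity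
  have hhigh : ∑ S with k < #S, biasedCoeff p F S ^ 2 ≤ M / k := by
    rw [le_div_iff₀ hk', sum_mul]
    have hle : ∑ S with k < #S, biasedCoeff p F S ^ 2 * (k : ℝ) ≤
        ∑ S with k < #S, (#S : ℝ) * biasedCoeff p F S ^ 2 := sum_le_sum fun S hS => by
      rw [mul_comm]
      exact mul_le_mul_of_nonneg_right (by exact_mod_cast (mem_filter.1 hS).2.le) (sq_nonneg _)
    refine hle.trans ((sum_le_sum_of_subset_of_nonneg (filter_subset _ _)
      fun S _ _ => by positivity).trans ?_)
    refine (sum_card_mul_biasedCoeff_sq_le h0 h1 F).trans ?_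
    simpa only [hD] using hM
  have hlow (i : ι) (hi : i ∉ J) : ∑ S with i ∈ S ∧ #S ≤ k, biasedCoeff p F S ^ 2 ≤
      biasedExp p (discDeriv i F) * (s * (4 * Λ) ^ k) := by
    refine (sum_biasedCoeff_sq_le_discDeriv h0 h1 F i k).trans ?_
    refine le_of_sq_le_sq ((sq_sum_low_biasedCoeff_le h0 h1 hΛ1 hΛ (hD i) k).trans ?_)
      (mul_nonneg (hD0 i) (by positivity))
    have h := mul_le_mul_of_nonneg_left (hJ i hi)
      (by positivity : 0 ≤ biasedExp p (discDeriv i F) ^ 2 * ((4 * Λ) ^ k) ^ 2)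
    linarith
  have hcover : ∑ S with ¬ S ⊆ J, biasedCoeff p F S ^ 2 ≤
      ∑ S with k < #S, biasedCoeff p F S ^ 2 +
        ∑ i ∈ Jᶜ, ∑ S with i ∈ S ∧ #S ≤ k, biasedCoeff p F S ^ 2 := by
    simp only [sum_filter]
    rw [sum_comm (s := Jᶜ), ← sum_add_distrib]
    refine sum_le_sum fun S _ => ?_
    have hnn (i : ι) (_ : i ∈ Jᶜ) :
        0 ≤ if i ∈ S ∧ #S ≤ k then biasedCoeff p F S ^ 2 else 0 := by positivity
    have hnn' := sum_nonneg hnn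
    by_cases hSJ : S ⊆ J
    · rw [if_neg (not_not.2 hSJ)]
      positivity
    rw [if_pos hSJ]
    by_cases hSk : k < #S
    · rw [if_pos hSk]
      exact le_add_of_nonneg_right hnn'
    · obtain ⟨i, hiS, hiJ⟩ := not_subset.1 hSJ
      have h := single_le_sum hnn (mem_compl.2 hiJ)
      rw [if_pos ⟨hiS, not_lt.1 hSk⟩] at h
      rw [if_neg hSk, zero_add]
      exact h
  refine hcover.trans (add_le_add hhigh ?_)
  refine (sum_le_sum fun i hi => hlow i (mem_compl.1 hi)).trans ?_
  rw [← sum_mul]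
  refine mul_le_mul_of_nonneg_right ?_ (by positivity)
  exact (sum_le_sum_of_subset_of_nonneg (subset_univ _) fun i _ _ => hD0 i).trans hM

/-- If a Boolean function `F` of mean more than `ε` is nearly determined by the coordinates in `J`,
then a Boolean function above `F` that ignores these coordinates has mean more than `1 - ε`. -/
lemma one_sub_lt_biasedExp_of_junta (h0 : 0 < p) (h1 : p < 1) {F F' : (ι → Bool) → ℝ}
    {J : Finset ι} {ε : ℝ} (hε : 0 < ε) (hε1 : ε ≤ 1 / 2)
    (hF : ∀ x, F x ^ 2 = F x) (hF' : ∀ x, F' x = 0 ∨ F' x = 1) (hle : ∀ x, F x ≤ F' x)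
    (hJ : ∀ i ∈ J, ∀ x b, F' (update x i b) = F' x)
    (hW : ∑ S with ¬ S ⊆ J, biasedCoeff p F S ^ 2 ≤ ε ^ 2 / 2) (hmean : ε < biasedExp p F) :
    1 - ε < biasedExp p F' := by
  by_contra! hcon
  set W := ∑ S with ¬ S ⊆ J, biasedCoeff p F S ^ 2 with hWdef
  -- `g` is the conditional expectation of `F` given the coordinates in `J`.
  set a : Finset ι → ℝ := fun S => if S ⊆ J then biasedCoeff p F S else 0 with ha
  set c : Finset ι → ℝ := fun S => if S ⊆ J then 0 else biasedCoeff p F S with hc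
  set g : (ι → Bool) → ℝ := fun x => ∑ S, a S * biasedChar p S x with hg
  set t : (ι → Bool) → ℝ := fun x => ∑ S, c S * biasedChar p S x with ht
  have hsum (x : ι → Bool) : F x = g x + t x := by
    rw [sum_biasedCoeff_mul_biasedChar h0 h1 F x, hg, ht, ← sum_add_distrib]
    refine sum_congr rfl fun S _ => ?_
    simp only [ha, hc]
    split_ifs <;> ring
  have ht2 : biasedExp p (fun x => t x ^ 2) = W := by
    rw [biasedExp_sq h0 h1, hWdef, sum_filter]
    refine sum_congr rfl fun S _ => ?_
    rw [ht, biasedCoeff_sum_biasedChar h0 h1, hc]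
    by_cases h : S ⊆ J <;> simp [h]
  have hg2 : biasedExp p (fun x => g x ^ 2) = biasedExp p F - W := by
    have hFF : biasedExp p F = ∑ S, biasedCoeff p F S ^ 2 := by
      rw [← biasedExp_sq h0 h1]; simp only [hF]
    rw [hFF, biasedExp_sq h0 h1, hWdef, sum_filter, ← sum_sub_distrib]
    refine sum_congr rfl fun S _ => ?_
    rw [hg, biasedCoeff_sum_biasedChar h0 h1, ha]
    by_cases h : S ⊆ J <;> simp [h]
  have hgJ : ∀ i ∉ J, ∀ x b, g (update x i b) ^ 2 = g x ^ 2 := fun i hi x b => by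
    congr 1
    refine sum_congr rfl fun S _ => ?_
    by_cases h : S ⊆ J
    · rw [biasedChar_update_of_notMem fun hS => hi (h hS)]
    · simp [ha, h]
  have hind : biasedExp p (fun x => g x ^ 2 * (1 - F' x)) =
      biasedExp p (fun x => g x ^ 2) * biasedExp p (fun x => 1 - F' x) :=
    biasedExp_mul_of_update h0 h1 hgJ fun i hi x b => by rw [hJ i hi]
  have hG : biasedExp p (fun x => 1 - F' x) = 1 - biasedExp p F' := by
    have h := biasedExp_add (p := p) (fun x => 1 - F' x) F'
    simp only [sub_add_cancel, biasedExp_one] at h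
    linarith
  -- Where `F'` vanishes, so does `F`, and `t` is the negative of `g`.
  have hpt (x : ι → Bool) : g x ^ 2 * (1 - F' x) ≤ t x ^ 2 := by
    rcases hF' x with h | h
    · have hFx : F x = 0 := by
        refine le_antisymm (h ▸ hle x) ?_
        rw [← hF]; positivity
      have : t x = -g x := by linarith [hsum x]
      rw [h, this]
      linarith [neg_sq (g x)]
    · rw [h]
      linarith [sq_nonneg (t x)]
  have hfin := biasedExp_mono h0.le h1.le hpt
  rw [hind, hg2, hG, ht2] at hfin
  have hpos : 0 < biasedExp p F - W := by nlinarith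
  nlinarith [mul_le_mul_of_nonneg_left (by linarith : ε ≤ 1 - biasedExp p F') hpos.le]

end Junta

/-! ### Influences of increasing events and boosting -/

section Boosting

variable {ι : Type*} [DecidableEq ι] {p : ℝ}

lemma discDeriv_indicator {A : Set (ι → Bool)} (hA : IsUpperSet A) (i : ι) (x : ι → Bool) :
    discDeriv i (A.indicator (1 : (ι → Bool) → ℝ)) x = 0 ∨
      discDeriv i (A.indicator (1 : (ι → Bool) → ℝ)) x = 1 := by
  have hle : update x i false ≤ update x i true :=
    update_le_update_iff.2 ⟨Bool.false_le _, fun _ _ => le_rfl⟩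
  by_cases hf : update x i false ∈ A
  · simp [discDeriv, hf, hA hle hf]
  · by_cases ht : update x i true ∈ A <;> simp [discDeriv, hf, ht]

variable [Fintype ι]

lemma biasedExp_discDeriv_indicator_nonneg (h0 : 0 ≤ p) (h1 : p ≤ 1) {A : Set (ι → Bool)}
    (hA : IsUpperSet A) (i : ι) : 0 ≤ biasedExp p (discDeriv i (A.indicator 1)) :=
  biasedExp_nonneg h0 h1 fun x => by rcases discDeriv_indicator hA i x with h | h <;> simp [h]

lemma monotoneOn_biasedExp_indicator {A : Set (ι → Bool)} (hA : IsUpperSet A) :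
    MonotoneOn (fun p => biasedExp p (A.indicator 1)) (Set.Icc 0 1) := by
  refine monotoneOn_of_deriv_nonneg (convex_Icc 0 1)
    (fun p _ => (hasDerivAt_biasedExp _ p).continuousAt.continuousWithinAt)
    (fun p _ => (hasDerivAt_biasedExp _ p).differentiableAt.differentiableWithinAt) fun p hp => ?_
  rw [interior_Icc] at hp
  rw [(hasDerivAt_biasedExp _ p).deriv]
  exact sum_nonneg fun i _ => biasedExp_discDeriv_indicator_nonneg hp.1.le hp.2.le hA i

lemma biasedExp_indicator_mem_Icc (h0 : 0 ≤ p) (h1 : p ≤ 1) (A : Set (ι → Bool)) :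
    biasedExp p (A.indicator 1) ∈ Set.Icc (0 : ℝ) 1 := by
  constructor
  · exact biasedExp_nonneg h0 h1 fun x => Set.indicator_nonneg (fun _ _ => zero_le_one) x
  · rw [← biasedExp_one (ι := ι) (p := p)]
    exact biasedExp_mono h0 h1 fun x => Set.indicator_le_self' (fun _ _ => zero_le_one) x

/-- Somewhere on an interval of biases, the total influence of an increasing event is at most the
reciprocal of the length of the interval. -/
lemma exists_sum_biasedExp_discDeriv_le {A : Set (ι → Bool)} {a b : ℝ} (ha : 0 ≤ a) (hab : a < b)
    (hb : b ≤ 1) :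
    ∃ p ∈ Set.Ioo a b, ∑ i, biasedExp p (discDeriv i (A.indicator 1)) ≤ (b - a)⁻¹ := by
  obtain ⟨p, hp, h⟩ := exists_hasDerivAt_eq_slope (fun p => biasedExp p (A.indicator 1))
    (fun p => ∑ i, biasedExp p (discDeriv i (A.indicator 1))) hab
    (fun p _ => (hasDerivAt_biasedExp _ p).continuousAt.continuousWithinAt)
    fun p _ => hasDerivAt_biasedExp _ p
  refine ⟨p, hp, ?_⟩
  rw [h, inv_eq_one_div]
  refine div_le_div_of_nonneg_right ?_ (sub_pos.2 hab).le
  have h1 := (biasedExp_indicator_mem_Icc (ha.trans hab.le) hb A).2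
  have h2 := (biasedExp_indicator_mem_Icc ha (hab.le.trans hb) A).1
  linarith

end Boosting

/-- Boosting at a bias where the total influence of `{r ≤ f}` is at most `M`: raising the few
influential coordinates to `1` lowers the threshold by at most their number. -/
lemma one_sub_lt_biasedExp_of_sum_discDeriv_le {n : ℕ} {f : (Fin n → Bool) → ℝ} (hf : Monotone f)
    (hlip : IsOneLipschitz f) {p Λ : ℝ} (h0 : 0 < p) (h1 : p < 1) (hΛ1 : 1 ≤ Λ)
    (hΛ : ∀ b, normBit p b ^ 2 ≤ Λ) {ε r M s T : ℝ} {k : ℕ} (hε : 0 < ε) (hε1 : ε ≤ 1 / 2)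
    (hmean : ε < biasedExp p ({x | r ≤ f x}.indicator 1))
    (hM : ∑ i, biasedExp p (discDeriv i ({x | r ≤ f x}.indicator 1)) ≤ M) (hk : 0 < k)
    (hs : 0 < s) (hW : M / k + M * (s * (4 * Λ) ^ k) ≤ ε ^ 2 / 2) (hT : M / s ^ 2 ≤ T) :
    1 - ε < biasedExp p ({x | r - T ≤ f x}.indicator 1) := by
  have hA : IsUpperSet {x | r ≤ f x} := fun x y hxy hx => le_trans hx (hf hxy)
  have h01 {B : Set (Fin n → Bool)} (x : Fin n → Bool) :
      B.indicator (1 : (Fin n → Bool) → ℝ) x = 0 ∨ B.indicator (1 : (Fin n → Bool) → ℝ) x = 1 := by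
    by_cases hx : x ∈ B <;> simp [hx]
  set J : Finset (Fin n) :=
    {i | s ^ 2 < biasedExp p (discDeriv i ({x | r ≤ f x}.indicator 1))} with hJ
  have hcard : (#J : ℝ) ≤ T := by
    refine le_trans ?_ hT
    rw [le_div_iff₀ (by positivity), ← nsmul_eq_mul]
    refine (card_nsmul_le_sum J _ _ fun i hi => (mem_filter.1 hi).2.le).trans ?_
    exact (sum_le_sum_of_subset_of_nonneg (subset_univ J) fun i _ _ =>
      biasedExp_discDeriv_indicator_nonneg h0.le h1.le hA i).trans hM
  have hbool {y : ℝ} (hy : y = 0 ∨ y = 1) : y ^ 2 = y := by rcases hy with rfl | rfl <;> norm_num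
  have hup (x : Fin n → Bool) : x ≤ J.piecewise (fun _ => true) x := fun i => by
    by_cases hi : i ∈ J <;> simp [hi, Bool.le_true]
  have hmain := one_sub_lt_biasedExp_of_junta
    (F' := {x | r ≤ f (J.piecewise (fun _ => true) x)}.indicator 1)
    h0 h1 hε hε1 (fun x => hbool (h01 x)) h01
    (Set.indicator_le_indicator_of_subset (fun x hx => le_trans hx (hf (hup x)))
      fun _ => zero_le_one)
    (fun i hi x b => by
      have : J.piecewise (fun _ => true) (update x i b) = J.piecewise (fun _ => true) x := by
        funext j
        by_cases hj : j ∈ J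
        · simp [hj]
        · simp [hj, update_of_ne (ne_of_mem_of_not_mem hi hj).symm]
      simp [Set.indicator_apply, this])
    ((sum_biasedCoeff_sq_not_subset_le h0 h1 hΛ1 hΛ
      (fun i x => hbool (discDeriv_indicator hA i x)) hs hM hk
      fun i hi => not_lt.1 fun h => hi (mem_filter.2 ⟨mem_univ i, h⟩)).trans hW) hmean
  refine hmain.trans_le (biasedExp_mono h0.le h1.le
    (Set.indicator_le_indicator_of_subset (fun x hx => ?_) fun _ => zero_le_one))
  have hdist : hammingDist (J.piecewise (fun _ => true) x) x ≤ #J :=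
    card_le_card fun i hi => by
      by_contra h
      simp [h] at hi
  have hl := (le_abs_self _).trans (hlip (J.piecewise (fun _ => true) x) x)
  have hd : (hammingDist (J.piecewise (fun _ => true) x) x : ℝ) ≤ #J := by exact_mod_cast hdist
  simp only [Set.mem_ofPred_eq] at hx ⊢
  linarith

/-- The size of the junta, with `t = 1 / ε ^ 2`, is at most exponential in `t`. -/
lemma junta_size_le {M R t : ℝ} (hM : 0 < M) (hR : 1 ≤ R) (ht : 1 ≤ t) {k : ℕ}
    (hk : (k : ℝ) ≤ 4 * M * t + 1) :
    16 * M ^ 3 * (R ^ k) ^ 2 * t ^ 2 ≤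
      ((16 * M ^ 3 + 1) * R ^ (2 * (4 * M + 1)) * Real.exp 2) ^ t := by
  have hR0 : 0 < R := by linarith
  rw [Real.mul_rpow (by positivity) (by positivity), Real.mul_rpow (by positivity) (by positivity)]
  have e1 : 16 * M ^ 3 ≤ (16 * M ^ 3 + 1) ^ t :=
    (by linarith : 16 * M ^ 3 ≤ 16 * M ^ 3 + 1).trans
      (Real.self_le_rpow_of_one_le (by linarith [pow_pos hM 3]) ht)
  have e2 : (R ^ k) ^ 2 ≤ (R ^ (2 * (4 * M + 1))) ^ t := by
    rw [← Real.rpow_mul hR0.le, ← pow_mul, ← Real.rpow_natCast]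
    refine Real.rpow_le_rpow_of_exponent_le hR ?_
    push_cast
    linarith
  have e3 : t ^ 2 ≤ Real.exp 2 ^ t := by
    rw [← Real.exp_mul, mul_comm, Real.exp_mul, Real.rpow_two]
    exact pow_le_pow_left₀ (by linarith) (by linarith [Real.add_one_le_exp t]) 2
  gcongr

theorem lemma3p2 (σ : ℝ) (hσ : 0 < σ) (hσ1 : 1.01 * σ ≤ 1) :
    ∃ C : ℝ, 0 < C ∧
      ∀ (n : ℕ) (f : (Fin n → Bool) → ℝ), (∀ x, 0 ≤ f x) → Monotone f → IsOneLipschitz f →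
        ∀ ε : ℝ, 0 < ε → ε ≤ 1 / 2 → ∀ r : ℝ, 1 ≤ r →
          ε < (biasedCube n ⟨σ, hσ.le, by linarith⟩).real {x | r ≤ f x} →
          1 - ε < (biasedCube n ⟨1.01 * σ, by linarith, hσ1⟩).real
            {x | r - C ^ (1 / ε ^ 2) ≤ f x} := by
  -- Stopping halfway, at `1.005 * σ`, keeps the bias away from `1` also when `1.01 * σ = 1`.
  set M : ℝ := (1.005 * σ - σ)⁻¹ with hMdef
  set Λ : ℝ := 1 / σ + 1000 with hΛdef
  have hM0 : 0 < M := inv_pos.2 (by linarith)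
  have hΛ1 : 1 ≤ Λ := by linarith [one_div_pos.2 hσ]
  refine ⟨(16 * M ^ 3 + 1) * (4 * Λ) ^ (2 * (4 * M + 1)) * Real.exp 2, by positivity, ?_⟩
  intro n f _ hf hlip ε hε hε1 r _ hmean
  rw [biasedCube_real_eq] at hmean ⊢
  dsimp only at hmean ⊢
  have hup (r : ℝ) : IsUpperSet {x | r ≤ f x} := fun x y hxy hx => le_trans hx (hf hxy)
  obtain ⟨p, hp, hinf⟩ := exists_sum_biasedExp_discDeriv_le (A := {x | r ≤ f x}) hσ.le
    (by linarith : σ < 1.005 * σ) (by linarith)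
  have hp0 : 0 < p := hσ.trans hp.1
  have hp1 : p < 1 := by linarith [hp.2]
  have hΛ : ∀ b, normBit p b ^ 2 ≤ Λ := normBit_sq_le hp0 hp1
    (by
      have : 1 / σ * σ ≤ 1 / σ * p := mul_le_mul_of_nonneg_left hp.1.le (by positivity)
      rw [one_div_mul_cancel hσ.ne'] at this
      linarith)
    (by
      have : 0 ≤ 1 / σ * (1 - p) := mul_nonneg (by positivity) (by linarith)
      linarith [hp.2])
  have hmean' : ε < biasedExp p ({x | r ≤ f x}.indicator 1) :=
    hmean.trans_le (monotoneOn_biasedExp_indicator (hup r) ⟨hσ.le, by linarith⟩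
      ⟨hp0.le, hp1.le⟩ hp.1.le)
  have ht : 1 ≤ 1 / ε ^ 2 := by
    rw [le_div_iff₀ (by positivity)]
    nlinarith
  set k : ℕ := ⌈4 * M * (1 / ε ^ 2)⌉₊ with hkdef
  have hk : 0 < k := Nat.ceil_pos.2 (by positivity)
  have hk1 : 4 * M * (1 / ε ^ 2) ≤ k := Nat.le_ceil _
  have hk2 : (k : ℝ) ≤ 4 * M * (1 / ε ^ 2) + 1 := (Nat.ceil_lt_add_one (by positivity)).le
  have hk0 : (0 : ℝ) < k := by exact_mod_cast hk
  have hR0 : 0 < (4 * Λ) ^ k := by positivity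
  -- With these values of `k` and `s`, each half of the Fourier tail is at most `ε ^ 2 / 4`.
  have hmain := one_sub_lt_biasedExp_of_sum_discDeriv_le hf hlip hp0 hp1 hΛ1 hΛ
    (s := ε ^ 2 / (4 * M * (4 * Λ) ^ k)) hε hε1 hmean' hinf hk (by positivity)
    (by
      have e1 : M / k ≤ ε ^ 2 / 4 := by
        rw [div_le_iff₀ hk0]
        rw [mul_one_div, div_le_iff₀ (by positivity)] at hk1
        linarith
      have e2 : M * (ε ^ 2 / (4 * M * (4 * Λ) ^ k) * (4 * Λ) ^ k) = ε ^ 2 / 4 := by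
        field_simp
      rw [← hMdef, e2]
      linarith)
    ((le_of_eq (by rw [← hMdef]; field_simp; ring)).trans
      (junta_size_le hM0 (by linarith : 1 ≤ 4 * Λ) ht hk2))
  exact hmain.trans_le (monotoneOn_biasedExp_indicator (hup _) ⟨hp0.le, hp1.le⟩
    ⟨by linarith, hσ1⟩ (by linarith [hp.2]))
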